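/- A skew brace is a set $B$ with two group structures $(B,+)$ and $(B,\circ)$, not necessarily abelian, such that $a\circ(b+c)=a\circ b-a+a\circ c$ for all $a,b,c\in B$; put $\lambda_a(b)=-a+a\circ b$ and $a\ast b=\lambda_a(b)-b$. An ideal of $B$ is a subgroup of $(B,+)$ that is invariant under all $\lambda_a$ and normal in both $(B,+)$ and $(B,\circ)$. A non-zero skew brace is simple if it has no ideals other than $0$ and itself. A trivial brace is a skew brace whose two operations coincide and are commutative. The radical $\operatorname{Rad}(B)$ is the intersection of all maximal ideals of $B$ (it is $B$ if there are none), and $\operatorname{Ann}(B)=\operatorname{Ker}(\lambda)\cap Z(B,+)\cap Z(B,\circ)$. The skew brace $B$ has property (S) if for every $x\in B$ the subgroup $\{b : x\ast b=0\}\cap C_{(B,+)}(x)$ has finite index in $(B,+)$ and the subgroup $\{b : b\ast x=0\}\cap C_{(B,\circ)}(x)$ has finite index in $(B,\circ)$. **Theorem.** Let $B$ be a skew brace with property (S) and let $R=\operatorname{Rad}(B)$. Let $C$ be the restricted direct product of all simple homomorphic images $B/I$ of $B$ which are not trivial braces, with one factor for each ideal $I$ of $B$ such that $B/I$ is simple and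 not a trivial brace. Then there is a trivial brace $D$, which is an unrestricted direct product of a (possibly empty or infinite) family of trivial braces of prime order, such that $B/R$ embeds as a skew brace into the direct product $C\times D$. Moreover, $B/A\cong C$ as skew braces, where $A$ is the ideal of $B$ containing $R$ with $A/R=\operatorname{Ann}(B/R)$. -/

import Mathlib

universe u v w

/-- A skew (left) brace: `+` and `*` (written `∘` on paper) are group operations, neither of them
assumed commutative, and `a ∘ (b + c) = a ∘ b - a + a ∘ c`. -/
class SkewBrace (B : Type u) extends AddGroup B, Group B where
  mul_add_skew : ∀ a b c : B, a * (b + c) = a * b - a + a * c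

namespace SkewBrace

/-- The map `λ_a (b) = -a + a ∘ b`. -/
def lam {B : Type u} [SkewBrace B] (a b : B) : B := -a + a * b

/-- The operation `a ∗ b = -a + a ∘ b - b = λ_a (b) - b`. -/
def star {B : Type u} [SkewBrace B] (a b : B) : B := -a + a * b - b

section basic

variable {B : Type u} [SkewBrace B]

theorem one_eq_zero : (1 : B) = 0 := by
  have h := mul_add_skew (1 : B) 0 0
  simp only [one_mul, add_zero, zero_sub] at h
  exact neg_eq_zero.mp h.symm

theorem mul_eq (a b : B) : a * b = a + lam a b := by simp [lam]

@[simp] theorem mul_zero' (a : B) : a * 0 = a := by rw [← one_eq_zero, mul_one]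

@[simp] theorem zero_mul' (a : B) : 0 * a = a := by rw [← one_eq_zero, one_mul]

@[simp] theorem lam_zero (a : B) : lam a 0 = 0 := by simp [lam]

theorem lam_add (a b c : B) : lam a (b + c) = lam a b + lam a c := by
  simp only [lam, mul_add_skew, sub_eq_add_neg, add_assoc]

theorem lam_neg (a b : B) : lam a (-b) = -lam a b := by
  rw [eq_neg_iff_add_eq_zero, ← lam_add, neg_add_cancel, lam_zero]

theorem lam_mul (a b c : B) : lam (a * b) c = lam a (lam b c) := by
  have h : lam a (-b + b * c) = lam a (-b) + lam a (b * c) := lam_add _ _ _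
  rw [show lam b c = -b + b * c from rfl, h, lam_neg]
  simp [lam, mul_assoc, add_assoc]

theorem lam_one (b : B) : lam (1 : B) b = b := by
  simp [lam, one_eq_zero]

theorem star_eq_zero_iff (a b : B) : star a b = 0 ↔ lam a b = b := sub_eq_zero

theorem lam_inv_neg_add (a b : B) : lam a⁻¹ (-a + b) = a⁻¹ * b := by
  rw [lam_add, lam_neg, lam, lam, inv_mul_cancel, one_eq_zero]
  simp

end basic

/-- `Fix^r(x) = {b | x ∗ b = 0}`, a subgroup of `(B, +)`. -/
def fixR {B : Type u} [SkewBrace B] (x : B) : AddSubgroup B where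
  carrier := {b | star x b = 0}
  zero_mem' := by simp [star_eq_zero_iff]
  add_mem' {a b} ha hb := by
    simp only [Set.mem_ofPred_eq, star_eq_zero_iff] at *
    rw [lam_add, ha, hb]
  neg_mem' {a} ha := by
    simp only [Set.mem_ofPred_eq, star_eq_zero_iff] at *
    rw [lam_neg, ha]

/-- `Fix^l(x) = {b | b ∗ x = 0}`, a subgroup of `(B, ∘)`. -/
def fixL {B : Type u} [SkewBrace B] (x : B) : Subgroup B where
  carrier := {b | star b x = 0}
  one_mem' := by simp [star_eq_zero_iff, lam_one]
  mul_mem' {a b} ha hb := by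
    simp only [Set.mem_ofPred_eq, star_eq_zero_iff] at *
    rw [lam_mul, hb, ha]
  inv_mem' {a} ha := by
    simp only [Set.mem_ofPred_eq, star_eq_zero_iff] at *
    nth_rewrite 1 [← ha]
    rw [← lam_mul, inv_mul_cancel, lam_one]

/-- Property (s) of an element `x`: the subgroup `Fix^r(x) ∩ C_x^+` of `(B, +)` and the subgroup
`Fix^l(x) ∩ C_x^∘` of `(B, ∘)` have finite index. -/
def HasPropertyElem {B : Type u} [SkewBrace B] (x : B) : Prop :=
  (fixR x ⊓ AddSubgroup.centralizer {x}).FiniteIndex ∧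
    (fixL x ⊓ Subgroup.centralizer {x}).FiniteIndex

/-- Property (S): all elements have property (s). -/
def HasPropertyS (B : Type u) [SkewBrace B] : Prop := ∀ x : B, HasPropertyElem x

/-- A trivial brace: the two operations coincide and are commutative. -/
def IsTrivialBrace (B : Type u) [SkewBrace B] : Prop :=
  ∀ a b : B, a * b = a + b ∧ a + b = b + a

end SkewBrace

/-- A homomorphism of skew braces. -/
structure SkewBraceHom (A : Type u) (B : Type v) [SkewBrace A] [SkewBrace B]
    extends A →+ B, A →* B

instance {A : Type u} {B : Type v} [SkewBrace A] [SkewBrace B] :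
    FunLike (SkewBraceHom A B) A B where
  coe f := f.toFun
  coe_injective f g h := by
    obtain ⟨⟨⟨f, _⟩, _⟩, _, _⟩ := f
    obtain ⟨⟨⟨g, _⟩, _⟩, _, _⟩ := g
    congr

/-- An ideal of a skew brace: a `λ`-invariant subgroup of `(B, +)` which is normal in `(B, +)`
and in `(B, ∘)`. -/
structure SkewBraceIdeal (B : Type u) [SkewBrace B] extends AddSubgroup B where
  lam_mem' : ∀ (a : B) {x : B}, x ∈ carrier → SkewBrace.lam a x ∈ carrier
  add_conj_mem' : ∀ (a : B) {x : B}, x ∈ carrier → a + x - a ∈ carrier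
  mul_conj_mem' : ∀ (a : B) {x : B}, x ∈ carrier → a * x * a⁻¹ ∈ carrier

namespace SkewBraceIdeal

open SkewBrace

section lattice

variable {B : Type u} [SkewBrace B]

instance : SetLike (SkewBraceIdeal B) B where
  coe I := I.carrier
  coe_injective I J h := by
    obtain ⟨I, _, _, _⟩ := I
    obtain ⟨J, _, _, _⟩ := J
    congr
    exact SetLike.coe_injective h

/-- Ideals are ordered by inclusion. -/
instance : PartialOrder (SkewBraceIdeal B) := PartialOrder.ofSetLike (SkewBraceIdeal B) B

instance : AddSubgroupClass (SkewBraceIdeal B) B where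
  add_mem {I} := I.add_mem'
  zero_mem I := I.zero_mem'
  neg_mem {I} := I.neg_mem'

/-- The whole brace, as an ideal. -/
instance : OrderTop (SkewBraceIdeal B) where
  top :=
    { (⊤ : AddSubgroup B) with
      lam_mem' := fun _ _ _ => trivial
      add_conj_mem' := fun _ _ _ => trivial
      mul_conj_mem' := fun _ _ _ => trivial }
  le_top _ _ _ := trivial

/-- The zero ideal. -/
instance : OrderBot (SkewBraceIdeal B) where
  bot :=
    { (⊥ : AddSubgroup B) with
      lam_mem' := by
        rintro a x rfl
        exact lam_zero a
      add_conj_mem' := by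
        rintro a x rfl
        exact (by simp : a + 0 - a = 0)
      mul_conj_mem' := by
        rintro a x rfl
        exact (by simp [one_eq_zero] : a * 0 * a⁻¹ = 0) }
  bot_le I x hx := by
    obtain rfl : x = 0 := hx
    exact I.zero_mem'

/-- The intersection of a set of ideals (the whole brace if the set is empty). -/
instance : InfSet (SkewBraceIdeal B) where
  sInf S :=
    { carrier := {x | ∀ I ∈ S, x ∈ I}
      zero_mem' := fun I _ => I.zero_mem'
      add_mem' := fun hx hy I hI => I.add_mem' (hx I hI) (hy I hI)
      neg_mem' := fun hx I hI => I.neg_mem' (hx I hI)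
      lam_mem' := fun a _ hx I hI => I.lam_mem' a (hx I hI)
      add_conj_mem' := fun a _ hx I hI => I.add_conj_mem' a (hx I hI)
      mul_conj_mem' := fun a _ hx I hI => I.mul_conj_mem' a (hx I hI) }

/-- The preimage of an ideal under a homomorphism. -/
def comap {A : Type v} [SkewBrace A] (f : SkewBraceHom A B) (J : SkewBraceIdeal B) :
    SkewBraceIdeal A :=
  { J.toAddSubgroup.comap f.toAddMonoidHom with
    carrier := {x | f x ∈ J}
    lam_mem' := fun a x hx => by
      have h : f (lam a x) = lam (f a) (f x) := by
        refine (map_add f.toAddMonoidHom (-a) (a * x)).trans ?_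
        exact congrArg₂ (· + ·) (map_neg f.toAddMonoidHom a) (f.map_mul' a x)
      change f (lam a x) ∈ J
      rw [h]
      exact J.lam_mem' (f a) hx
    add_conj_mem' := fun a x hx => by
      have h : f (a + x - a) = f a + f x - f a := by
        refine (map_sub f.toAddMonoidHom (a + x) a).trans ?_
        exact congrArg (· - f a) (map_add f.toAddMonoidHom a x)
      change f (a + x - a) ∈ J
      rw [h]
      exact J.add_conj_mem' (f a) hx
    mul_conj_mem' := fun a x hx => by
      have h : f (a * x * a⁻¹) = f a * f x * (f a)⁻¹ := by
        refine (map_mul f.toMonoidHom (a * x) a⁻¹).trans ?_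
        exact congrArg₂ (· * ·) (map_mul f.toMonoidHom a x) (map_inv f.toMonoidHom a)
      change f (a * x * a⁻¹) ∈ J
      rw [h]
      exact J.mul_conj_mem' (f a) hx }

end lattice

section quotient

variable {B : Type u} [SkewBrace B] (I : SkewBraceIdeal B)

theorem mul_mem' {x y : B} (hx : x ∈ I) (hy : y ∈ I) : x * y ∈ I := by
  rw [mul_eq]
  exact add_mem hx (I.lam_mem' x hy)

theorem neg_add_mem_iff {a b : B} : -a + b ∈ I ↔ a⁻¹ * b ∈ I := by
  constructor
  · intro h
    rw [← lam_inv_neg_add]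
    exact I.lam_mem' _ h
  · intro h
    have := I.lam_mem' a h
    rwa [lam, mul_inv_cancel_left] at this

/-- Congruence modulo `I`: `a ≡ b` if and only if `-a + b ∈ I`. -/
def setoid : Setoid B where
  r a b := -a + b ∈ I
  iseqv :=
    { refl := fun a => by
        rw [neg_add_cancel]
        exact zero_mem I
      symm := fun {a b} h => by
        have := neg_mem h
        rwa [neg_add_rev, neg_neg] at this
      trans := fun {a b c} h k => by
        have := add_mem h k
        rwa [add_assoc, add_neg_cancel_left] at this }

/-- Congruence modulo `I` respects `+`. -/
def addCon : AddCon B where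
  toSetoid := I.setoid
  add' {a b c d} h k := by
    change -(a + c) + (b + d) ∈ I
    have h1 := I.add_conj_mem' (-c) h
    have h2 := add_mem (show -c + (-a + b) - -c ∈ I from h1) (show -c + d ∈ I from k)
    simpa [add_assoc, sub_eq_add_neg] using h2

/-- Congruence modulo `I` respects `∘`. -/
def mulCon : Con B where
  toSetoid := I.setoid
  mul' {a b c d} h k := by
    change -(a * c) + (b * d) ∈ I
    rw [neg_add_mem_iff]
    have h1 := I.mul_conj_mem' c⁻¹ (I.neg_add_mem_iff.mp h)
    have h2 := I.mul_mem' (show c⁻¹ * (a⁻¹ * b) * c⁻¹⁻¹ ∈ I from h1) (I.neg_add_mem_iff.mp k)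
    simpa [mul_assoc] using h2

instance : HasQuotient B (SkewBraceIdeal B) where
  Quotient I := _root_.Quotient I.setoid

instance : AddGroup (B ⧸ I) := inferInstanceAs (AddGroup I.addCon.Quotient)

instance : Group (B ⧸ I) := inferInstanceAs (Group I.mulCon.Quotient)

/-- The quotient skew brace `B / I`, with the operations induced by those of `B`. -/
instance : SkewBrace (B ⧸ I) where
  mul_add_skew := by
    rintro ⟨a⟩ ⟨b⟩ ⟨c⟩
    exact congrArg (Quotient.mk I.setoid) (SkewBrace.mul_add_skew a b c)

/-- The canonical projection `B → B / I`. -/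
def proj : SkewBraceHom B (B ⧸ I) where
  toFun x := Quotient.mk I.setoid x
  map_zero' := rfl
  map_add' _ _ := rfl
  map_one' := rfl
  map_mul' _ _ := rfl

end quotient

end SkewBraceIdeal

namespace SkewBrace

/-- `B` is simple: non-zero, with no ideals other than `0` and `B`. -/
def IsSimple (B : Type u) [SkewBrace B] : Prop :=
  Nontrivial B ∧ ∀ I : SkewBraceIdeal B, I = ⊥ ∨ I = ⊤

/-- `Rad(B)`: the intersection of all maximal ideals of `B` (which is `B` if there are none). -/
def Rad (B : Type u) [SkewBrace B] : SkewBraceIdeal B := sInf {I | IsCoatom I}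

/-- The annihilator `Ann(B) = Ker(λ) ∩ Z(B, +) ∩ Z(B, ∘)`. -/
def Ann (B : Type u) [SkewBrace B] : SkewBraceIdeal B where
  carrier := {x | (∀ b : B, lam x b = b) ∧ x ∈ AddSubgroup.center B ∧ x ∈ Subgroup.center B}
  zero_mem' := by
    refine ⟨fun b => by simp [lam], zero_mem _, ?_⟩
    rw [← one_eq_zero]
    exact one_mem _
  add_mem' {x y} hx hy := by
    have h : x + y = x * y := by rw [mul_eq, hx.1]
    refine ⟨fun b => ?_, add_mem hx.2.1 hy.2.1, ?_⟩
    · rw [h, lam_mul, hy.1, hx.1]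
    · rw [h]
      exact mul_mem hx.2.2 hy.2.2
  neg_mem' {x} hx := by
    have h : -x = x⁻¹ := by
      rw [eq_inv_iff_mul_eq_one, Subgroup.mem_center_iff.mp hx.2.2, mul_eq, hx.1, one_eq_zero,
        add_neg_cancel]
    refine ⟨fun b => ?_, neg_mem hx.2.1, ?_⟩
    · rw [h]
      nth_rewrite 1 [← hx.1 b]
      rw [← lam_mul, inv_mul_cancel, lam_one]
    · rw [h]
      exact inv_mem hx.2.2
  lam_mem' a x hx := by
    have h : lam a x = x := by
      rw [lam, Subgroup.mem_center_iff.mp hx.2.2, mul_eq, hx.1,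
        ← AddSubgroup.mem_center_iff.mp hx.2.1, neg_add_cancel_left]
    rw [h]
    exact hx
  add_conj_mem' a x hx := by
    rw [AddSubgroup.mem_center_iff.mp hx.2.1, add_sub_cancel_right]
    exact hx
  mul_conj_mem' a x hx := by
    rw [Subgroup.mem_center_iff.mp hx.2.2, mul_inv_cancel_right]
    exact hx

/-- The unrestricted direct product of a family of skew braces. -/
instance instPi {ι : Type v} (E : ι → Type w) [∀ i, SkewBrace (E i)] :
    SkewBrace (∀ i, E i) where
  mul_add_skew a b c := funext fun i => mul_add_skew (a i) (b i) (c i)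

/-- The direct product of two skew braces. -/
instance instProd (A : Type u) (B : Type v) [SkewBrace A] [SkewBrace B] :
    SkewBrace (A × B) where
  mul_add_skew a b c := Prod.ext (mul_add_skew a.1 b.1 c.1) (mul_add_skew a.2 b.2 c.2)

/-- The restricted direct product: the families with only finitely many non-zero entries. -/
def RestrictedProduct {ι : Type v} (E : ι → Type w) [∀ i, SkewBrace (E i)] :
    Type (max v w) :=
  {f : ∀ i, E i // {i | f i ≠ 0}.Finite}

namespace RestrictedProduct

variable {ι : Type v} (E : ι → Type w) [∀ i, SkewBrace (E i)]

/-- The families with finite support, as a subgroup for `+`. -/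
def addSubgroup : AddSubgroup (∀ i, E i) where
  carrier := {f | {i | f i ≠ 0}.Finite}
  zero_mem' := by simp
  add_mem' {f g} hf hg := by
    refine (Set.Finite.union hf hg).subset fun i hi => ?_
    by_contra h
    simp only [Set.mem_union, Set.mem_ofPred_eq, not_or, not_not] at h
    exact hi (by simp [h.1, h.2])
  neg_mem' {f} hf := by
    refine Set.Finite.subset hf fun i hi => ?_
    simpa using hi

/-- The families with finite support, as a subgroup for `∘`. -/
def subgroup : Subgroup (∀ i, E i) where
  carrier := {f | {i | f i ≠ 0}.Finite}
  one_mem' := by simp [one_eq_zero]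
  mul_mem' {f g} hf hg := by
    refine (Set.Finite.union hf hg).subset fun i hi => ?_
    by_contra h
    simp only [Set.mem_union, Set.mem_ofPred_eq, not_or, not_not] at h
    exact hi (by simp [h.1, h.2])
  inv_mem' {f} hf := by
    refine Set.Finite.subset hf fun i hi => ?_
    simpa [← one_eq_zero] using hi

instance : AddGroup (RestrictedProduct E) := inferInstanceAs (AddGroup (addSubgroup E))

instance : Group (RestrictedProduct E) := inferInstanceAs (Group (subgroup E))

/-- The operations of the restricted direct product are componentwise. -/
instance : SkewBrace (RestrictedProduct E) where
  mul_add_skew a b c := Subtype.ext (mul_add_skew a.1 b.1 c.1)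

end RestrictedProduct

/-- The restricted direct product of all simple homomorphic images `B / I` of `B` which are not
trivial braces, with one factor for each ideal `I` of this kind. -/
abbrev SimpleImagesProduct (B : Type u) [SkewBrace B] : Type u :=
  RestrictedProduct fun I : {I : SkewBraceIdeal B // IsSimple (B ⧸ I) ∧ ¬ IsTrivialBrace (B ⧸ I)} =>
    B ⧸ I.1

end SkewBrace

open SkewBrace

namespace SkewBraceHom

variable {A : Type u} {B : Type v} [SkewBrace A] [SkewBrace B]

instance : AddMonoidHomClass (SkewBraceHom A B) A B where
  map_add f := f.map_add'
  map_zero f := f.map_zero'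

instance : MonoidHomClass (SkewBraceHom A B) A B where
  map_mul f := f.map_mul'
  map_one f := f.map_one'

theorem map_lam (f : SkewBraceHom A B) (a b : A) : f (lam a b) = lam (f a) (f b) := by
  simp only [lam, map_add, map_neg, map_mul]

/-- The homomorphism of a quotient induced by a homomorphism that vanishes on the ideal. -/
def lift (f : SkewBraceHom A B) (I : SkewBraceIdeal A) (h : ∀ x ∈ I, f x = 0) :
    SkewBraceHom (A ⧸ I) B where
  toFun := Quotient.lift f fun a b hab => by
    have : f (-a + b) = 0 := h _ hab
    rwa [map_add, map_neg, neg_add_eq_zero] at this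
  map_zero' := map_zero f
  map_add' := by
    rintro ⟨a⟩ ⟨b⟩
    exact map_add f a b
  map_one' := map_one f
  map_mul' := by
    rintro ⟨a⟩ ⟨b⟩
    exact map_mul f a b

end SkewBraceHom

namespace SkewBraceIdeal

variable {B : Type u} [SkewBrace B]

theorem proj_surjective (I : SkewBraceIdeal B) : Function.Surjective I.proj := by
  rintro ⟨x⟩
  exact ⟨x, rfl⟩

theorem proj_eq_proj (I : SkewBraceIdeal B) {a b : B} : I.proj a = I.proj b ↔ -a + b ∈ I :=
  Quotient.eq (r := I.setoid)

theorem proj_eq_zero (I : SkewBraceIdeal B) {a : B} : I.proj a = 0 ↔ a ∈ I := by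
  rw [← map_zero I.proj, eq_comm, proj_eq_proj, neg_zero, zero_add]

theorem lift_injective {C : Type v} [SkewBrace C] (f : SkewBraceHom B C) (I : SkewBraceIdeal B)
    (h : ∀ x, x ∈ I ↔ f x = 0) :
    Function.Injective (f.lift I fun x hx => (h x).mp hx) := by
  rw [injective_iff_map_eq_zero]
  intro a ha
  obtain ⟨a, rfl⟩ := I.proj_surjective a
  exact I.proj_eq_zero.mpr ((h a).mpr ha)

theorem mem_sInf {S : Set (SkewBraceIdeal B)} {x : B} : x ∈ sInf S ↔ ∀ I ∈ S, x ∈ I := Iff.rfl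

theorem mem_comap {C : Type v} [SkewBrace C] (f : SkewBraceHom B C) (J : SkewBraceIdeal C) {x : B} :
    x ∈ comap f J ↔ f x ∈ J := Iff.rfl

theorem mem_top (x : B) : x ∈ (⊤ : SkewBraceIdeal B) := trivial

theorem mem_bot {x : B} : x ∈ (⊥ : SkewBraceIdeal B) ↔ x = 0 := Iff.rfl

theorem eq_top_of_forall {I : SkewBraceIdeal B} (h : ∀ x, x ∈ I) : I = ⊤ :=
  top_le_iff.mp fun x _ => h x

/-- The sum of two ideals. -/
def add (I J : SkewBraceIdeal B) : SkewBraceIdeal B where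
  carrier := {x | ∃ i ∈ I, ∃ j ∈ J, i + j = x}
  zero_mem' := ⟨0, zero_mem I, 0, zero_mem J, add_zero 0⟩
  add_mem' := by
    rintro _ _ ⟨i, hi, j, hj, rfl⟩ ⟨i', hi', j', hj', rfl⟩
    exact ⟨i + (j + i' - j), add_mem hi (I.add_conj_mem' j hi'), j + j', add_mem hj hj',
      by simp [sub_eq_add_neg, add_assoc]⟩
  neg_mem' := by
    rintro _ ⟨i, hi, j, hj, rfl⟩
    exact ⟨-j + -i - -j, I.add_conj_mem' (-j) (neg_mem hi), -j, neg_mem hj,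
      by simp [sub_eq_add_neg, add_assoc]⟩
  lam_mem' := by
    rintro a _ ⟨i, hi, j, hj, rfl⟩
    exact ⟨lam a i, I.lam_mem' a hi, lam a j, J.lam_mem' a hj, (lam_add a i j).symm⟩
  add_conj_mem' := by
    rintro a _ ⟨i, hi, j, hj, rfl⟩
    exact ⟨a + i - a, I.add_conj_mem' a hi, a + j - a, J.add_conj_mem' a hj,
      by simp [sub_eq_add_neg, add_assoc]⟩
  mul_conj_mem' := by
    rintro a _ ⟨i, hi, j, hj, rfl⟩
    refine ⟨a * i * a⁻¹, I.mul_conj_mem' a hi,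
      lam (a * i * a⁻¹) (a * lam i⁻¹ j * a⁻¹),
      J.lam_mem' _ (J.mul_conj_mem' a (J.lam_mem' _ hj)), ?_⟩
    rw [← mul_eq, ← mul_inv_cancel_left i (i + j), ← lam_inv_neg_add i (i + j),
      neg_add_cancel_left]
    group

theorem le_add_left (I J : SkewBraceIdeal B) : I ≤ add I J := fun x hx =>
  ⟨x, hx, 0, zero_mem J, add_zero x⟩

theorem le_add_right (I J : SkewBraceIdeal B) : J ≤ add I J := fun x hx =>
  ⟨0, zero_mem I, x, hx, zero_add x⟩

theorem exists_add_eq_of_isCoatom {I M : SkewBraceIdeal B} (hM : IsCoatom M) (h : ¬ I ≤ M) (x : B) :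
    ∃ i ∈ I, ∃ m ∈ M, i + m = x := by
  have hlt : M < add I M :=
    lt_of_le_of_ne (le_add_right I M) fun he => h (he ▸ le_add_left I M)
  have : x ∈ add I M := hM.2 _ hlt ▸ mem_top x
  exact this

theorem exists_proj_eq_of_isCoatom {I M : SkewBraceIdeal B} (hM : IsCoatom M) (h : ¬ I ≤ M)
    (x : B ⧸ M) : ∃ i ∈ I, M.proj i = x := by
  obtain ⟨x, rfl⟩ := M.proj_surjective x
  obtain ⟨i, hi, m, hm, rfl⟩ := exists_add_eq_of_isCoatom hM h x
  exact ⟨i, hi, M.proj_eq_proj.mpr (by rwa [neg_add_cancel_left])⟩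

/-- The image of an ideal in a quotient. -/
def mapProj (I J : SkewBraceIdeal B) : SkewBraceIdeal (B ⧸ I) where
  carrier := {y | ∃ x ∈ J, I.proj x = y}
  zero_mem' := ⟨0, zero_mem J, map_zero _⟩
  add_mem' := by
    rintro _ _ ⟨x, hx, rfl⟩ ⟨y, hy, rfl⟩
    exact ⟨x + y, add_mem hx hy, map_add _ _ _⟩
  neg_mem' := by
    rintro _ ⟨x, hx, rfl⟩
    exact ⟨-x, neg_mem hx, map_neg _ _⟩
  lam_mem' := by
    rintro a _ ⟨x, hx, rfl⟩
    obtain ⟨a, rfl⟩ := I.proj_surjective a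
    exact ⟨lam a x, J.lam_mem' a hx, I.proj.map_lam a x⟩
  add_conj_mem' := by
    rintro a _ ⟨x, hx, rfl⟩
    obtain ⟨a, rfl⟩ := I.proj_surjective a
    exact ⟨a + x - a, J.add_conj_mem' a hx, by simp⟩
  mul_conj_mem' := by
    rintro a _ ⟨x, hx, rfl⟩
    obtain ⟨a, rfl⟩ := I.proj_surjective a
    exact ⟨a * x * a⁻¹, J.mul_conj_mem' a hx, by simp⟩

theorem isSimple_quotient_iff {M : SkewBraceIdeal B} : IsSimple (B ⧸ M) ↔ IsCoatom M := by
  constructor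
  · rintro ⟨⟨a, b, hab⟩, h⟩
    refine ⟨?_, fun J hJ => ?_⟩
    · rintro rfl
      obtain ⟨a, rfl⟩ := proj_surjective _ a
      obtain ⟨b, rfl⟩ := proj_surjective _ b
      exact hab ((proj_eq_proj _).mpr (mem_top _))
    · rcases h (mapProj M J) with h | h
      · refine absurd (fun x hx => ?_) hJ.not_ge
        have : M.proj x ∈ mapProj M J := ⟨x, hx, rfl⟩
        rw [h] at this
        exact M.proj_eq_zero.mp this
      · refine eq_top_of_forall fun x => ?_
        obtain ⟨y, hy, hyx⟩ : M.proj x ∈ mapProj M J := h ▸ mem_top _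
        have := add_mem hy (hJ.le (M.proj_eq_proj.mp hyx))
        rwa [add_neg_cancel_left] at this
  · intro h
    constructor
    · by_contra hn
      rw [not_nontrivial_iff_subsingleton] at hn
      exact h.1 (eq_top_of_forall fun x => M.proj_eq_zero.mp (Subsingleton.elim _ _))
    · intro J
      have hle : M ≤ comap M.proj J := fun x hx => by
        rw [mem_comap, M.proj_eq_zero.mpr hx]
        exact zero_mem J
      rcases hle.eq_or_lt with he | hlt
      · refine .inl (le_bot_iff.mp fun y hy => ?_)
        obtain ⟨x, rfl⟩ := M.proj_surjective y
        have : x ∈ M := he ▸ hy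
        exact M.proj_eq_zero.mpr this
      · refine .inr (eq_top_of_forall fun y => ?_)
        obtain ⟨x, rfl⟩ := M.proj_surjective y
        have : x ∈ comap M.proj J := h.2 _ hlt ▸ mem_top x
        exact this

theorem add_comm_mem (I : SkewBraceIdeal B) {x : B} (hx : x ∈ I) (b : B) :
    -(x + b) + (b + x) ∈ I := by
  have := add_mem (I.add_conj_mem' (-b) (neg_mem hx)) hx
  simpa [sub_eq_add_neg, add_assoc] using this

theorem add_comm_mem' (I : SkewBraceIdeal B) {x : B} (hx : x ∈ I) (b : B) :
    -(b + x) + (x + b) ∈ I := by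
  have := neg_mem (I.add_comm_mem hx b)
  rwa [neg_add_rev, neg_neg] at this

theorem neg_add_lam_mem (I : SkewBraceIdeal B) {x : B} (hx : x ∈ I) (b : B) :
    -b + lam x b ∈ I := by
  have h1 : b⁻¹ * x * b⁻¹⁻¹ ∈ I := I.mul_conj_mem' b⁻¹ hx
  rw [inv_inv] at h1
  have h2 : lam b (b⁻¹ * x * b) = -b + (x + lam x b) := by
    rw [← mul_eq, lam]
    group
  have h3 : -b + (x + lam x b) ∈ I := h2 ▸ I.lam_mem' b h1
  have h4 := add_mem (I.add_conj_mem' (-b) (neg_mem hx)) h3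
  simpa [sub_eq_add_neg, add_assoc] using h4

theorem neg_add_lam_mem' (I : SkewBraceIdeal B) {x : B} (hx : x ∈ I) (b : B) :
    -x + lam b x ∈ I := add_mem (neg_mem hx) (I.lam_mem' b hx)

/-- An ideal with a simple quotient that is not a trivial brace is prime for intersections. -/
theorem inf_not_le {I J K M : SkewBraceIdeal B} (hM : IsCoatom M) (ht : ¬ IsTrivialBrace (B ⧸ M))
    (hI : ¬ I ≤ M) (hJ : ¬ J ≤ M) (hK : ∀ x, x ∈ I → x ∈ J → x ∈ K) : ¬ K ≤ M := by
  intro h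
  refine ht fun a b => ?_
  obtain ⟨a, ha, rfl⟩ := exists_proj_eq_of_isCoatom hM hI a
  obtain ⟨b, hb, rfl⟩ := exists_proj_eq_of_isCoatom hM hJ b
  constructor
  · rw [mul_eq, ← SkewBraceHom.map_lam, add_right_inj, eq_comm, proj_eq_proj]
    exact h (hK _ (neg_add_lam_mem I ha b) (neg_add_lam_mem' J hb a))
  · rw [← map_add, ← map_add, proj_eq_proj]
    exact h (hK _ (add_comm_mem I ha b) (add_comm_mem' J hb a))

theorem sInf_finite_not_le {M : SkewBraceIdeal B} (hM : IsCoatom M)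
    (ht : ¬ IsTrivialBrace (B ⧸ M)) {S : Set (SkewBraceIdeal B)} (hS : S.Finite)
    (h : ∀ N ∈ S, ¬ N ≤ M) : ¬ sInf S ≤ M := by
  induction S, hS using Set.Finite.induction_on with
  | empty => exact fun hle => hM.1 (eq_top_of_forall fun x => hle (mem_sInf.mpr (by simp)))
  | @insert N S _ _ ih =>
    refine inf_not_le hM ht (h N (Set.mem_insert N S))
      (ih fun N' hN' => h N' (Set.mem_insert_of_mem N hN')) fun x hx hx' => ?_
    rw [mem_sInf]
    rintro L (rfl | hL)
    · exact hx
    · exact hx' L hL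

end SkewBraceIdeal

@[to_additive]
theorem Subgroup.finite_setOf_ge {G : Type u} [Group G] (H : Subgroup G) [H.FiniteIndex] :
    {K : Subgroup G | H ≤ K}.Finite := by
  refine Set.Finite.of_finite_image (f := fun K : Subgroup G => ((↑) '' (K : Set G) : Set (G ⧸ H)))
    (Set.toFinite _) fun K hK L hL h => ?_
  have key : ∀ K L : Subgroup G, H ≤ L →
      ((↑) '' (K : Set G) : Set (G ⧸ H)) = (↑) '' (L : Set G) → K ≤ L := by
    intro K L hL h x hx
    obtain ⟨y, hy, hyx⟩ := h.subset ⟨x, hx, rfl⟩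
    have := L.mul_mem hy (hL (QuotientGroup.eq.mp hyx))
    rwa [mul_inv_cancel_left] at this
  exact le_antisymm (key K L hL h) (key L K hK h.symm)

namespace SkewBrace

open SkewBraceIdeal

variable {B : Type u} [SkewBrace B]

theorem isTrivialBrace_of_ann_eq_top (h : Ann B = ⊤) : IsTrivialBrace B := fun a b => by
  have ha : a ∈ Ann B := h ▸ mem_top a
  exact ⟨by rw [mul_eq, ha.1], (AddSubgroup.mem_center_iff.mp ha.2.1 b).symm⟩

theorem ann_eq_bot (hs : IsSimple B) (ht : ¬ IsTrivialBrace B) : Ann B = ⊥ :=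
  (hs.2 _).resolve_right fun h => ht (isTrivialBrace_of_ann_eq_top h)

theorem mem_ann_of_forall {x : B} (h1 : ∀ b, lam x b = b) (h2 : ∀ b, lam b x = x)
    (h3 : ∀ b, b + x = x + b) : x ∈ Ann B :=
  ⟨h1, AddSubgroup.mem_center_iff.mpr h3, Subgroup.mem_center_iff.mpr fun b => by
    rw [mul_eq, mul_eq, h1, h2, h3]⟩

theorem finite_setOf_isCoatom_le_addSubgroup (H : AddSubgroup B) [H.FiniteIndex] :
    {M : SkewBraceIdeal B | IsCoatom M ∧ ∃ K : AddSubgroup B,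
      K ≠ ⊤ ∧ H ≤ K ∧ ∀ x ∈ M, x ∈ K}.Finite := by
  choose! K hK using fun (M : SkewBraceIdeal B) (h : ∃ K : AddSubgroup B,
      K ≠ ⊤ ∧ H ≤ K ∧ ∀ x ∈ M, x ∈ K) => h
  refine Set.Finite.of_finite_image (f := K) (H.finite_setOf_ge.subset ?_) ?_
  · rintro _ ⟨M, hM, rfl⟩
    exact (hK M hM.2).2.1
  · intro M hM N hN h
    by_contra hne
    refine (hK M hM.2).1 ((AddSubgroup.eq_top_iff' _).mpr fun x => ?_)
    obtain ⟨i, hi, j, hj, rfl⟩ := exists_add_eq_of_isCoatom hN.1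
      (fun hle => hne (hM.1.le_iff_eq hN.1.1 |>.mp hle).symm) x
    exact add_mem ((hK M hM.2).2.2 i hi) (h ▸ (hK N hN.2).2.2 j hj)

theorem finite_setOf_isCoatom_le_subgroup (H : Subgroup B) [H.FiniteIndex] :
    {M : SkewBraceIdeal B | IsCoatom M ∧ ∃ K : Subgroup B,
      K ≠ ⊤ ∧ H ≤ K ∧ ∀ x ∈ M, x ∈ K}.Finite := by
  choose! K hK using fun (M : SkewBraceIdeal B) (h : ∃ K : Subgroup B,
      K ≠ ⊤ ∧ H ≤ K ∧ ∀ x ∈ M, x ∈ K) => h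
  refine Set.Finite.of_finite_image (f := K) (H.finite_setOf_ge.subset ?_) ?_
  · rintro _ ⟨M, hM, rfl⟩
    exact (hK M hM.2).2.1
  · intro M hM N hN h
    by_contra hne
    refine (hK M hM.2).1 ((Subgroup.eq_top_iff' _).mpr fun x => ?_)
    obtain ⟨i, hi, j, hj, rfl⟩ := exists_add_eq_of_isCoatom hN.1
      (fun hle => hne (hM.1.le_iff_eq hN.1.1 |>.mp hle).symm) x
    have hj' : i⁻¹ * (i + j) ∈ N := N.neg_add_mem_iff.mp (by rwa [neg_add_cancel_left])
    have := mul_mem ((hK M hM.2).2.2 i hi) (h ▸ (hK N hN.2).2.2 _ hj' : i⁻¹ * (i + j) ∈ K M)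
    rwa [mul_inv_cancel_left] at this

/-- In a skew brace with property (S), an element lies in almost all ideals whose quotient is simple
and not a trivial brace. -/
theorem HasPropertyElem.finite_setOf_notMem {x : B} (hx : HasPropertyElem x) :
    {M : SkewBraceIdeal B | (IsSimple (B ⧸ M) ∧ ¬ IsTrivialBrace (B ⧸ M)) ∧ x ∉ M}.Finite := by
  have := hx.1
  have := hx.2
  refine ((finite_setOf_isCoatom_le_addSubgroup (fixR x ⊓ AddSubgroup.centralizer {x})).union
    (finite_setOf_isCoatom_le_subgroup (fixL x ⊓ Subgroup.centralizer {x}))).subset ?_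
  rintro M ⟨⟨hs, ht⟩, hxM⟩
  have hM := isSimple_quotient_iff.mp hs
  by_contra hn
  rw [Set.mem_union, not_or] at hn
  have h1 : (fixR (M.proj x) ⊓ AddSubgroup.centralizer {M.proj x}).comap
      M.proj.toAddMonoidHom = ⊤ := by
    by_contra hne
    refine hn.1 ⟨hM, _, hne, fun y hy => ?_, fun y hy => ?_⟩
    · have h1 : lam x y = y := (star_eq_zero_iff x y).mp hy.1
      have h2 := AddSubgroup.mem_centralizer_singleton_iff.mp hy.2
      refine ⟨(star_eq_zero_iff (M.proj x) (M.proj y)).mpr ?_,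
        AddSubgroup.mem_centralizer_singleton_iff.mpr ?_⟩
      · rw [← SkewBraceHom.map_lam, h1]
      · exact (map_add M.proj _ _).symm.trans ((congrArg M.proj h2).trans (map_add M.proj _ _))
    · refine AddSubgroup.mem_comap.mpr ?_
      rw [show M.proj.toAddMonoidHom y = 0 from M.proj_eq_zero.mpr hy]
      exact zero_mem _
  have h2 : (fixL (M.proj x) ⊓ Subgroup.centralizer {M.proj x}).comap
      M.proj.toMonoidHom = ⊤ := by
    by_contra hne
    refine hn.2 ⟨hM, _, hne, fun y hy => ?_, fun y hy => ?_⟩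
    · have h1 : lam y x = x := (star_eq_zero_iff y x).mp hy.1
      have h2 := Subgroup.mem_centralizer_singleton_iff.mp hy.2
      refine ⟨(star_eq_zero_iff (M.proj y) (M.proj x)).mpr ?_,
        Subgroup.mem_centralizer_singleton_iff.mpr ?_⟩
      · rw [← SkewBraceHom.map_lam, h1]
      · exact (map_mul M.proj _ _).symm.trans ((congrArg M.proj h2).trans (map_mul M.proj _ _))
    · refine Subgroup.mem_comap.mpr ?_
      rw [show M.proj.toMonoidHom y = 1 from (M.proj_eq_zero.mpr hy).trans one_eq_zero.symm]
      exact one_mem _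
  have hann : M.proj x ∈ Ann (B ⧸ M) := by
    refine mem_ann_of_forall (fun b => ?_) (fun b => ?_) fun b => ?_ <;>
      obtain ⟨b, rfl⟩ := M.proj_surjective b
    · exact (star_eq_zero_iff (M.proj x) (M.proj b)).mp ((AddSubgroup.eq_top_iff' _).mp h1 b).1
    · exact (star_eq_zero_iff (M.proj b) (M.proj x)).mp ((Subgroup.eq_top_iff' _).mp h2 b).1
    · exact AddSubgroup.mem_centralizer_singleton_iff.mp ((AddSubgroup.eq_top_iff' _).mp h1 b).2
  rw [ann_eq_bot hs ht] at hann
  exact hxM (M.proj_eq_zero.mp hann)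

/-- The canonical homomorphism to the restricted product of the simple images that are not trivial
braces. -/
def toSimpleImagesProduct (hS : HasPropertyS B) : SkewBraceHom B (SimpleImagesProduct B) where
  toFun x := ⟨fun M => M.1.proj x, by
    refine Set.Finite.of_finite_image (f := Subtype.val)
      ((hS x).finite_setOf_notMem.subset ?_) Subtype.val_injective.injOn
    rintro _ ⟨M, hM, rfl⟩
    exact ⟨M.2, fun h => hM (M.1.proj_eq_zero.mpr h)⟩⟩
  map_zero' := rfl
  map_add' _ _ := rfl
  map_one' := rfl
  map_mul' _ _ := rfl

theorem toSimpleImagesProduct_eq_zero (hS : HasPropertyS B) {x : B} :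
    toSimpleImagesProduct hS x = 0 ↔
      ∀ M : SkewBraceIdeal B, IsSimple (B ⧸ M) ∧ ¬ IsTrivialBrace (B ⧸ M) → x ∈ M := by
  refine Subtype.ext_iff.trans (funext_iff.trans ⟨fun h M hM => ?_, fun h M => ?_⟩)
  · exact M.proj_eq_zero.mp (h ⟨M, hM⟩)
  · exact M.1.proj_eq_zero.mpr (h M.1 M.2)

theorem exists_proj_eq_and_forall_mem (hS : HasPropertyS B) {M : SkewBraceIdeal B}
    (hs : IsSimple (B ⧸ M)) (ht : ¬ IsTrivialBrace (B ⧸ M)) (b : B ⧸ M) :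
    ∃ y, M.proj y = b ∧ ∀ N : SkewBraceIdeal B,
      IsSimple (B ⧸ N) ∧ ¬ IsTrivialBrace (B ⧸ N) → N ≠ M → y ∈ N := by
  have hM := isSimple_quotient_iff.mp hs
  obtain ⟨x, hx⟩ : ∃ x, x ∉ M := by
    by_contra! h
    exact hM.1 (eq_top_of_forall h)
  let T : Set (SkewBraceIdeal B) := {N | (IsSimple (B ⧸ N) ∧ ¬ IsTrivialBrace (B ⧸ N)) ∧ N ≠ M}
  have hT : ¬ sInf T ≤ M := by
    refine inf_not_le (I := sInf {N ∈ T | x ∈ N}) (J := sInf {N ∈ T | x ∉ N}) hM ht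
      (fun h => hx (h fun N hN => hN.2)) ?_ fun y h1 h2 N hN => ?_
    · refine sInf_finite_not_le hM ht ((hS x).finite_setOf_notMem.subset
        fun N hN => ⟨hN.1.1, hN.2⟩) fun N hN hle => hN.1.2 ?_
      exact ((isSimple_quotient_iff.mp hN.1.1.1).le_iff_eq hM.1 |>.mp hle).symm
    · by_cases hxN : x ∈ N
      · exact h1 N ⟨hN, hxN⟩
      · exact h2 N ⟨hN, hxN⟩
  obtain ⟨y, hy, rfl⟩ := exists_proj_eq_of_isCoatom hM hT b
  exact ⟨y, rfl, fun N hN hne => hy N ⟨hN, hne⟩⟩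

theorem toSimpleImagesProduct_surjective (hS : HasPropertyS B) :
    Function.Surjective (toSimpleImagesProduct hS) := by
  classical
  have key : ∀ (s : Finset {I : SkewBraceIdeal B // IsSimple (B ⧸ I) ∧ ¬ IsTrivialBrace (B ⧸ I)})
      (f : ∀ M : {I : SkewBraceIdeal B // IsSimple (B ⧸ I) ∧ ¬ IsTrivialBrace (B ⧸ I)}, B ⧸ M.1),
      (∀ M, f M ≠ 0 → M ∈ s) → ∃ x : B, ∀ M, M.1.proj x = f M := by
    intro s
    induction s using Finset.induction_on with
    | empty =>
      intro f hf
      refine ⟨0, fun M => ?_⟩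
      rw [map_zero]
      by_contra h
      exact absurd (hf M (Ne.symm h)) (Finset.notMem_empty M)
    | insert N s _ ih =>
      intro f hf
      obtain ⟨x, hx⟩ := ih (Function.update f N 0) fun M hM => by
        rcases eq_or_ne M N with rfl | hne
        · simp at hM
        · rw [Function.update_of_ne hne] at hM
          exact (Finset.mem_insert.mp (hf M hM)).resolve_left hne
      obtain ⟨y, hy, hy'⟩ := exists_proj_eq_and_forall_mem hS N.2.1 N.2.2 (f N)
      refine ⟨x + y, fun M => ?_⟩
      rw [map_add, hx]
      rcases eq_or_ne M N with rfl | hne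
      · rw [Function.update_self, zero_add, hy]
      · rw [Function.update_of_ne hne,
          M.1.proj_eq_zero.mpr (hy' M.1 M.2 fun h => hne (Subtype.ext h)), add_zero]
  rintro ⟨f, hf⟩
  obtain ⟨x, hx⟩ := key hf.toFinset f fun M hM => hf.mem_toFinset.mpr hM
  exact ⟨x, Subtype.ext (funext hx)⟩

theorem IsTrivialBrace.lam_eq (ht : IsTrivialBrace B) (a b : B) : lam a b = b := by
  rw [lam, (ht a b).1, neg_add_cancel_left]

/-- A simple trivial brace has prime order. -/
theorem IsTrivialBrace.prime_card (ht : IsTrivialBrace B) (hs : IsSimple B) :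
    (Nat.card B).Prime := by
  have := hs.1
  let : AddCommGroup B := { (inferInstance : AddGroup B) with add_comm := fun a b => (ht a b).2 }
  have : IsSimpleAddGroup B := by
    refine ⟨fun H _ => ?_⟩
    let I : SkewBraceIdeal B :=
      { H with
        lam_mem' := fun a x hx => by rwa [ht.lam_eq]
        add_conj_mem' := fun a x hx => by rwa [(ht a x).2, add_sub_cancel_right]
        mul_conj_mem' := fun a x hx => by
          rwa [(ht a x).1, (ht a x).2, ← (ht x a).1, mul_inv_cancel_right] }
    rcases hs.2 I with h | h
    · refine .inl ((AddSubgroup.eq_bot_iff_forall _).mpr fun x hx => ?_)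
      have : x ∈ I := hx
      rwa [h] at this
    · refine .inr ((AddSubgroup.eq_top_iff' _).mpr fun x => ?_)
      have : x ∈ I := h ▸ mem_top x
      exact this
  exact IsSimpleAddGroup.prime_card

theorem mem_rad_iff {x : B} : x ∈ Rad B ↔ ∀ M : SkewBraceIdeal B, IsSimple (B ⧸ M) → x ∈ M :=
  ⟨fun h M hM => h M (isSimple_quotient_iff.mp hM), fun h M hM => h M (isSimple_quotient_iff.mpr hM)⟩

/-- The annihilator modulo the radical is the intersection of the ideals whose quotient is simple
and not a trivial brace. -/
theorem mem_comap_ann_iff {x : B} :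
    x ∈ (Ann (B ⧸ Rad B)).comap (Rad B).proj ↔
      ∀ M : SkewBraceIdeal B, IsSimple (B ⧸ M) ∧ ¬ IsTrivialBrace (B ⧸ M) → x ∈ M := by
  constructor
  · rintro ⟨h1, h2, h3⟩ M ⟨hs, ht⟩
    have hle : ∀ y z, (Rad B).proj y = (Rad B).proj z → M.proj y = M.proj z := fun y z h =>
      M.proj_eq_proj.mpr (mem_rad_iff.mp ((Rad B).proj_eq_proj.mp h) M hs)
    rw [← M.proj_eq_zero, ← mem_bot, ← ann_eq_bot hs ht]
    refine ⟨fun b => ?_, AddSubgroup.mem_center_iff.mpr fun b => ?_,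
      Subgroup.mem_center_iff.mpr fun b => ?_⟩ <;> obtain ⟨b, rfl⟩ := M.proj_surjective b
    · exact (SkewBraceHom.map_lam _ _ _).symm.trans
        (hle _ _ ((SkewBraceHom.map_lam _ _ _).trans (h1 ((Rad B).proj b))))
    · exact hle (b + x) (x + b) (AddSubgroup.mem_center_iff.mp h2 ((Rad B).proj b))
    · exact hle (b * x) (x * b) (Subgroup.mem_center_iff.mp h3 ((Rad B).proj b))
  · intro h
    have key : ∀ y z, (∀ M : SkewBraceIdeal B, IsSimple (B ⧸ M) → IsTrivialBrace (B ⧸ M) →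
        M.proj y = M.proj z) → (∀ M : SkewBraceIdeal B, x ∈ M → M.proj y = M.proj z) →
        (Rad B).proj y = (Rad B).proj z := by
      intro y z h1 h2
      rw [proj_eq_proj, mem_rad_iff]
      intro M hM
      rw [← proj_eq_proj]
      by_cases ht : IsTrivialBrace (B ⧸ M)
      · exact h1 M hM ht
      · exact h2 M (h M ⟨hM, ht⟩)
    rw [mem_comap]
    refine mem_ann_of_forall (fun b => ?_) (fun b => ?_) fun b => ?_ <;>
      obtain ⟨b, rfl⟩ := (Rad B).proj_surjective b
    · rw [← SkewBraceHom.map_lam]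
      refine key _ _ (fun M _ ht => ?_) fun M hx => ?_
      · rw [SkewBraceHom.map_lam, ht.lam_eq]
      · exact (M.proj_eq_proj.mpr (neg_add_lam_mem M hx b)).symm
    · rw [← SkewBraceHom.map_lam]
      refine key _ _ (fun M _ ht => ?_) fun M hx => ?_
      · rw [SkewBraceHom.map_lam, ht.lam_eq]
      · exact (M.proj_eq_proj.mpr (neg_add_lam_mem' M hx b)).symm
    · rw [← map_add, ← map_add]
      refine key _ _ (fun M _ ht => ?_) fun M hx => ?_
      · rw [map_add, map_add, (ht _ _).2]
      · exact M.proj_eq_proj.mpr (add_comm_mem' M hx b)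

/-- The canonical homomorphism to the product of the simple images that are trivial braces. -/
def toTrivialImagesProduct (B : Type u) [SkewBrace B] :
    SkewBraceHom B (∀ M : {I : SkewBraceIdeal B // IsSimple (B ⧸ I) ∧ IsTrivialBrace (B ⧸ I)},
      B ⧸ M.1) where
  toFun x M := M.1.proj x
  map_zero' := rfl
  map_add' _ _ := rfl
  map_one' := rfl
  map_mul' _ _ := rfl

theorem toTrivialImagesProduct_eq_zero {x : B} :
    toTrivialImagesProduct B x = 0 ↔
      ∀ M : SkewBraceIdeal B, IsSimple (B ⧸ M) ∧ IsTrivialBrace (B ⧸ M) → x ∈ M :=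
  funext_iff.trans ⟨fun h M hM => M.proj_eq_zero.mp (h ⟨M, hM⟩),
    fun h M => M.1.proj_eq_zero.mpr (h M.1 M.2)⟩

end SkewBrace

/-- The homomorphism to a product with two given components. -/
def SkewBraceHom.prod {A : Type u} {B : Type v} {C : Type w} [SkewBrace A] [SkewBrace B]
    [SkewBrace C] (f : SkewBraceHom A B) (g : SkewBraceHom A C) : SkewBraceHom A (B × C) where
  toFun x := (f x, g x)
  map_zero' := Prod.ext (map_zero f) (map_zero g)
  map_add' x y := Prod.ext (map_add f x y) (map_add g x y)
  map_one' := Prod.ext (map_one f) (map_one g)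
  map_mul' x y := Prod.ext (map_mul f x y) (map_mul g x y)

/-- The isomorphism `≃+*` in the last line is a bijection preserving `+` and `∘`. -/
theorem mainTheorem9 (B : Type u) [SkewBrace B] (hS : SkewBrace.HasPropertyS B) :
    (∃ (T : Type u) (E : T → Type u) (_ : ∀ t, SkewBrace (E t)),
      (∀ t, SkewBrace.IsTrivialBrace (E t) ∧ (Nat.card (E t)).Prime) ∧
      ∃ f : SkewBraceHom (B ⧸ SkewBrace.Rad B)
          (SkewBrace.SimpleImagesProduct B × (∀ t, E t)),
        Function.Injective f) ∧
    Nonempty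
      ((B ⧸ (SkewBrace.Ann (B ⧸ SkewBrace.Rad B)).comap (SkewBraceIdeal.proj (SkewBrace.Rad B)))
        ≃+* SkewBrace.SimpleImagesProduct B) := by
  constructor
  · refine ⟨_, fun M : {I : SkewBraceIdeal B // IsSimple (B ⧸ I) ∧ IsTrivialBrace (B ⧸ I)} =>
      B ⧸ M.1, fun M => inferInstance, fun M => ⟨M.2.2, M.2.2.prime_card M.2.1⟩, _,
      SkewBraceIdeal.lift_injective
        ((toSimpleImagesProduct hS).prod (toTrivialImagesProduct B)) (Rad B) fun x => ?_⟩
    refine Iff.trans ?_ Prod.ext_iff.symm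
    refine Iff.trans ?_ (and_congr (toSimpleImagesProduct_eq_zero hS)
      toTrivialImagesProduct_eq_zero).symm
    rw [mem_rad_iff]
    refine ⟨fun h => ⟨fun M hM => h M hM.1, fun M hM => h M hM.1⟩, fun h M hM => ?_⟩
    by_cases ht : IsTrivialBrace (B ⧸ M)
    · exact h.2 M ⟨hM, ht⟩
    · exact h.1 M ⟨hM, ht⟩
  · have h : ∀ x, x ∈ (Ann (B ⧸ Rad B)).comap (Rad B).proj ↔ toSimpleImagesProduct hS x = 0 :=
      fun x => mem_comap_ann_iff.trans (toSimpleImagesProduct_eq_zero hS).symm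
    let g := (toSimpleImagesProduct hS).lift _ fun x hx => (h x).mp hx
    have hg : Function.Bijective g := by
      refine ⟨SkewBraceIdeal.lift_injective _ _ h, fun y => ?_⟩
      obtain ⟨x, rfl⟩ := toSimpleImagesProduct_surjective hS y
      exact ⟨SkewBraceIdeal.proj _ x, rfl⟩
    exact ⟨{ Equiv.ofBijective g hg with
      map_add' := map_add g
      map_mul' := map_mul g }⟩
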